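/- Fix a dimension $d\ge 2$, a radius $B>0$, a regularization parameter $\lambda>0$ and a privacy level $\epsilon>0$, and let $\Theta_B=\{\theta\in\mathbb R^d:\langle \mathbf 1,\theta\rangle=0,\ \|\theta\|_2\le B\}$. For fixed known differential features $x_1,\dots,x_n\in\mathbb R^d$, in the Bradley–Terry–Luce (BTL) model with parameter $\theta$ the labels $y_1,\dots,y_n\in\{0,1\}$ are independent with $\mathbb P_\theta[y_i=1]=\sigma(x_i^\top\theta)$, where $\sigma(z)=1/(1+e^{-z})$. In the local model the estimator does not see the labels: each $y_i$ is first privatized, independently, by a local randomizer $\mathcal R_i$ (a Markov kernel from $\{0,1\}$ to a measurable space $\mathcal Z$), and an estimator $\hat\theta$ is a measurable, possibly randomized, function of the private views $z_i\sim\mathcal R_i(y_i)$, $i=1,\dots,n$ (it may depend on $x_1,\dots,x_n$). It is $\epsilon$-label DP in the local model if, for every $i$, all $y,y'\in\{0,1\}$ and all measurable $S\subseteq \mathcal Z$, $\mathbb P[\mathcal R_i(y)\in S]\le e^{\epsilon}\,\mathbb P[\mathcal R_i(y')\in S]$. Let $\Sigma_{\mathcal D}=\frac1n\sum_{i=1}^n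 x_ix_i^\top$ and $\|v\|_A=\sqrt{v^\top A v}$. **Theorem (semi-norm lower bound).** There is a universal constant $c>0$ such that for all $d\ge2$ and $B,\lambda,\epsilon>0$ there is an $N$, depending only on $d,B,\lambda,\epsilon$, such that for every $n\ge N$, all $x_1,\dots,x_n\in\mathbb R^d$, and every estimator $\hat\theta$ based on $n$ samples from the BTL model that is $\epsilon$-label DP in the local model, there is a parameter $\theta^*\in\Theta_B$ with $$\mathbb E_{\theta^*}\Big[\|\hat\theta-\theta^*\|_{\Sigma_{\mathcal D}+\lambda I}^2\Big]\ \ge\ c\left(\frac dn+\frac{d}{(e^{\epsilon}-1)^2\,n}\right),$$ where the expectation is over the labels, the local randomizers and the randomness of $\hat\theta$. -/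

import Mathlib

open MeasureTheory ProbabilityTheory
open scoped ENNReal

noncomputable section

/-- The parameter set `Θ_B = {θ ∈ ℝ^d : ⟨1, θ⟩ = 0, ‖θ‖ ≤ B}` (Euclidean norm). -/
def paramSet (d : ℕ) (B : ℝ) : Set (EuclideanSpace ℝ (Fin d)) :=
  {θ | ∑ j, θ j = 0 ∧ ‖θ‖ ≤ B}

/-- The law of one label `y ∈ {0, 1}` (`true` is `1`) in the linear Bradley-Terry-Luce model with
parameter `θ`, for a pair of actions with differential feature `x = φ(s, a¹) - φ(s, a⁰)`:
`P(y = 1) = σ(⟨x, θ⟩) = exp ⟨φ(s, a¹), θ⟩ / (exp ⟨φ(s, a⁰), θ⟩ + exp ⟨φ(s, a¹), θ⟩)`,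
where `σ(z) = 1 / (1 + exp (-z))`. -/
def btlLabelLaw {d : ℕ} (x θ : EuclideanSpace ℝ (Fin d)) : Measure Bool :=
  ENNReal.ofReal (Real.sigmoid (inner ℝ x θ)) • Measure.dirac true +
    ENNReal.ofReal (1 - Real.sigmoid (inner ℝ x θ)) • Measure.dirac false

/-- A local randomizer `R`, which maps a label to a random element of `Z`, is `ε`-label
differentially private. -/
def IsLabelDP {Z : Type*} [MeasurableSpace Z] (ε : ℝ) (R : Kernel Bool Z) : Prop :=
  ∀ (y y' : Bool) (S : Set Z), MeasurableSet S → R y S ≤ ENNReal.ofReal (Real.exp ε) * R y' S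

/-- The law of the private view `(z_1, …, z_n)`: the labels `y_i` are independent, `y_i` follows the
BTL model with differential feature `x i` and parameter `θ`, and each label is privatized
separately, `z_i ∼ R i (y_i)`. -/
def privateViewLaw {d n : ℕ} {Z : Type*} [MeasurableSpace Z]
    (x : Fin n → EuclideanSpace ℝ (Fin d)) (R : Fin n → Kernel Bool Z)
    (θ : EuclideanSpace ℝ (Fin d)) : Measure (Fin n → Z) :=
  Measure.pi fun i => (btlLabelLaw (x i) θ).bind (R i)

/-- The sample covariance matrix `Σ_D = (1/n) ∑ i, x_i x_iᵀ` of the differential features. -/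
def sampleCov {d n : ℕ} (x : Fin n → EuclideanSpace ℝ (Fin d)) : Matrix (Fin d) (Fin d) ℝ :=
  (n : ℝ)⁻¹ • ∑ i, Matrix.vecMulVec (x i).ofLp (x i).ofLp

/-- The matrix-weighted (semi-)norm `‖v‖_A = √(vᵀ A v)`, for a positive semidefinite matrix `A`. -/
def matrixNorm {d : ℕ} (A : Matrix (Fin d) (Fin d) ℝ) (v : EuclideanSpace ℝ (Fin d)) : ℝ :=
  Real.sqrt (v.ofLp ⬝ᵥ A.mulVec v.ofLp)

/-- The risk `E ‖θ̂ - θ‖²_{Σ_D + λ I}` at the parameter `θ` of the estimator `est`, a (possibly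
randomized) function of the private view only; it may be infinite. -/
def semiNormRisk {d n : ℕ} {Z : Type*} [MeasurableSpace Z] (lam : ℝ)
    (x : Fin n → EuclideanSpace ℝ (Fin d)) (R : Fin n → Kernel Bool Z)
    (est : Kernel (Fin n → Z) (EuclideanSpace ℝ (Fin d))) (θ : EuclideanSpace ℝ (Fin d)) : ℝ≥0∞ :=
  ∫⁻ z, ∫⁻ t, ENNReal.ofReal (matrixNorm (sampleCov x + lam • 1) (t - θ) ^ 2) ∂(est z)
    ∂(privateViewLaw x R θ)

end

/-!
Assouad's method on a cube adapted to `Σ_D + λ I`, with `κ = min(1, (exp ε - 1)²)`.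

Label differential privacy makes the density `r` of a private view under label `1` relative to the
view under label `0` satisfy `exp (-ε) ≤ r ≤ exp ε`. Hence the views of one label under two
parameters `θ, θ'` have Bhattacharyya affinity at least `1 - κ ⟨x_i, θ - θ'⟩²`: the factor `1` holds
for any randomizer by data processing, and `(exp ε - 1)²` because the two mixtures differ only by a
multiple of `r - 1`. The affinity is multiplicative over the `n` independent views, so the
distributions of the whole private view overlap substantially as soon as
`κ ∑ i, ⟨x_i, θ - θ'⟩² ≤ 1/4`.

Choose `d - 1` vectors in the hyperplane `⟨1, v⟩ = 0` that are orthonormal for `Σ_D + λ I`; each of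
them satisfies `∑ i, ⟨x_i, u_j⟩² ≤ n`. The vertices `∑ j, ± δ u_j` with `δ² = 1 / (16 κ n)` are then
statistically hard to tell apart along each edge, so at some vertex the squared error is of order
`(d - 1) δ²`, and for large `n` all vertices lie in `Θ_B`.
-/

section ScalarInequalities

theorem sqrt_mul_le_add_div_two {p q : ℝ} (hp : 0 ≤ p) (hq : 0 ≤ q) : √(p * q) ≤ (p + q) / 2 :=
  Real.sqrt_le_iff.2 ⟨by positivity, by nlinarith [sq_nonneg (p - q)]⟩

theorem sqrt_mul_sub_le_min {p q : ℝ} (hp : 0 ≤ p) (hq : 0 ≤ q) :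
    √(p * q) - (p + q) / 4 ≤ min p q := by
  have le_left : √(p * q) ≤ p + q / 4 :=
    Real.sqrt_le_iff.2 ⟨by positivity, by nlinarith [sq_nonneg (p - q / 4)]⟩
  have le_right : √(p * q) ≤ p / 4 + q :=
    Real.sqrt_le_iff.2 ⟨by positivity, by nlinarith [sq_nonneg (p / 4 - q)]⟩
  exact le_min (by linarith) (by linarith)

theorem add_div_two_sub_le_sqrt_mul {p q c : ℝ} (hc : 0 ≤ c)
    (hpq : (p - q) ^ 2 ≤ 2 * c * (p + q)) : (p + q) / 2 - c ≤ √(p * q) := by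
  rcases le_total c ((p + q) / 2) with hle | hle
  · have hsq : c * c ≤ c * ((p + q) / 2) := by gcongr
    exact Real.le_sqrt_of_sq_le (by linarith)
  · exact (sub_nonpos.2 hle).trans (Real.sqrt_nonneg _)

theorem sqrt_mul_add_sqrt_mul_le {a b c d : ℝ} (ha : 0 ≤ a) (hb : 0 ≤ b) (hc : 0 ≤ c)
    (hd : 0 ≤ d) : √(a * c) + √(b * d) ≤ √((a + b) * (c + d)) := by
  have amgm : √((a * d) * (b * c)) ≤ (a * d + b * c) / 2 :=
    sqrt_mul_le_add_div_two (by positivity) (by positivity)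
  have cross : √(a * c) * √(b * d) = √((a * d) * (b * c)) := by
    rw [← Real.sqrt_mul (by positivity)]
    ring_nf
  refine Real.le_sqrt_of_sq_le ?_
  rw [add_sq, Real.sq_sqrt (by positivity), Real.sq_sqrt (by positivity), mul_assoc, cross]
  linarith

theorem one_sub_sum_le_prod {ι : Type*} {s : Finset ι} {b h : ι → ℝ}
    (b_nonneg : ∀ i ∈ s, 0 ≤ b i) (b_le_one : ∀ i ∈ s, b i ≤ 1) (hb : ∀ i ∈ s, 1 - h i ≤ b i) :
    1 - ∑ i ∈ s, h i ≤ ∏ i ∈ s, b i := by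
  induction s using Finset.cons_induction with
  | empty => simp
  | cons a s ha ih =>
    simp only [Finset.forall_mem_cons] at b_nonneg b_le_one hb
    rw [Finset.sum_cons, Finset.prod_cons]
    have prod_le_one : ∏ i ∈ s, b i ≤ 1 := Finset.prod_le_one b_nonneg.2 b_le_one.2
    linarith [ih b_nonneg.2 b_le_one.2 hb.2, hb.1,
      mul_nonneg (sub_nonneg.2 b_le_one.1) (sub_nonneg.2 prod_le_one)]

theorem sq_sub_one_le_mul_min {a C : ℝ} (ha : 0 ≤ a) (hle : a ≤ C) (hge : 1 ≤ C * a) :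
    (a - 1) ^ 2 ≤ (C - 1) ^ 2 * min 1 a := by
  rcases le_total 1 a with h | h
  · rw [min_eq_left h, mul_one]
    gcongr
  · rw [min_eq_right h]
    calc (a - 1) ^ 2 = (1 - a) ^ 2 := by ring
      _ ≤ ((C - 1) * a) ^ 2 := by gcongr; linarith
      _ = (C - 1) ^ 2 * (a * a) := by ring
      _ ≤ (C - 1) ^ 2 * a := by gcongr; nlinarith

theorem sigmoid_mem_Icc (y : ℝ) : Real.sigmoid y ∈ Set.Icc 0 1 :=
  ⟨Real.sigmoid_nonneg y, Real.sigmoid_le_one y⟩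

theorem sigmoid_sub_eq (a b : ℝ) : Real.sigmoid a - Real.sigmoid b =
    Real.sigmoid a * (1 - Real.sigmoid b) * (1 - Real.exp (b - a)) := by
  have exp_sub : Real.exp (b - a) = Real.exp (-a) / Real.exp (-b) := by
    rw [← Real.exp_sub]
    ring_nf
  rw [exp_sub, Real.sigmoid_def, Real.sigmoid_def]
  field_simp
  ring

theorem sigmoid_sub_le (a b : ℝ) : Real.sigmoid a - Real.sigmoid b ≤
    Real.sigmoid a * (1 - Real.sigmoid b) * (a - b) := by
  have coeff_nonneg : 0 ≤ Real.sigmoid a * (1 - Real.sigmoid b) :=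
    mul_nonneg (Real.sigmoid_nonneg a) (sub_nonneg.2 (Real.sigmoid_le_one b))
  rw [sigmoid_sub_eq]
  exact mul_le_mul_of_nonneg_left (by linarith [Real.add_one_le_exp (b - a)]) coeff_nonneg

theorem sq_sigmoid_sub_le_mul_add (a b : ℝ) :
    (Real.sigmoid a - Real.sigmoid b) ^ 2 ≤ (a - b) ^ 2 * (Real.sigmoid a + Real.sigmoid b) := by
  wlog hab : b ≤ a generalizing a b
  · linarith [this b a (le_of_not_ge hab)]
  have a_nonneg := Real.sigmoid_nonneg a
  have b_nonneg := Real.sigmoid_nonneg b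
  have diff_nonneg : 0 ≤ Real.sigmoid a - Real.sigmoid b := sub_nonneg.2 (Real.sigmoid_le hab)
  have diff_le : Real.sigmoid a - Real.sigmoid b ≤ Real.sigmoid a * (a - b) :=
    (sigmoid_sub_le a b).trans (by gcongr; nlinarith)
  calc (Real.sigmoid a - Real.sigmoid b) ^ 2
      ≤ (Real.sigmoid a * (a - b)) ^ 2 := by gcongr
    _ = (a - b) ^ 2 * (Real.sigmoid a * Real.sigmoid a) := by ring
    _ ≤ (a - b) ^ 2 * (Real.sigmoid a + Real.sigmoid b) := by
        gcongr
        nlinarith [Real.sigmoid_le_one a]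

theorem sq_sigmoid_sub_le (a b : ℝ) : (Real.sigmoid a - Real.sigmoid b) ^ 2 ≤ (a - b) ^ 2 := by
  have reflected := sq_sigmoid_sub_le_mul_add (-a) (-b)
  rw [Real.sigmoid_neg, Real.sigmoid_neg] at reflected
  linarith [sq_sigmoid_sub_le_mul_add a b]

theorem one_sub_sq_le_sqrt_sigmoid (a b : ℝ) : 1 - (a - b) ^ 2 ≤
    √(Real.sigmoid a * Real.sigmoid b) + √((1 - Real.sigmoid a) * (1 - Real.sigmoid b)) := by
  have hc : 0 ≤ (a - b) ^ 2 / 2 := by positivity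
  have label_one := add_div_two_sub_le_sqrt_mul hc
    ((sq_sigmoid_sub_le_mul_add a b).trans_eq (by ring))
  have label_zero := add_div_two_sub_le_sqrt_mul hc
    ((sq_sigmoid_sub_le_mul_add (-a) (-b)).trans_eq (by ring))
  rw [Real.sigmoid_neg, Real.sigmoid_neg] at label_zero
  linarith

end ScalarInequalities

section Affinity

variable {Z : Type*} [MeasurableSpace Z] {μ : Measure Z} {p q : Z → ℝ}

/-- A real-valued probability density with respect to `μ`, nonnegative everywhere rather than
almost everywhere. -/
structure IsProbDensity (μ : Measure Z) (p : Z → ℝ) : Prop where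
  measurable : Measurable p
  nonneg : ∀ z, 0 ≤ p z
  integral_eq_one : ∫ z, p z ∂μ = 1

theorem IsProbDensity.integrable (hp : IsProbDensity μ p) : Integrable p μ :=
  .of_integral_ne_zero (hp.integral_eq_one ▸ one_ne_zero)

/-- The Bhattacharyya affinity of two probability densities with respect to `μ`, which equals `1`
minus their squared Hellinger distance and, unlike the total variation distance, is multiplicative
over products. -/
noncomputable def affinity (μ : Measure Z) (p q : Z → ℝ) : ℝ :=
  ∫ z, √(p z * q z) ∂μ

theorem affinity_nonneg (μ : Measure Z) (p q : Z → ℝ) : 0 ≤ affinity μ p q :=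
  integral_nonneg fun _ => Real.sqrt_nonneg _

theorem IsProbDensity.integral_add_div_two (hp : IsProbDensity μ p) (hq : IsProbDensity μ q) :
    ∫ z, (p z + q z) / 2 ∂μ = 1 := by
  rw [integral_div, integral_add hp.integrable hq.integrable, hp.integral_eq_one,
    hq.integral_eq_one]
  norm_num

theorem IsProbDensity.integrable_add_div_two (hp : IsProbDensity μ p) (hq : IsProbDensity μ q) :
    Integrable (fun z => (p z + q z) / 2) μ :=
  (hp.integrable.add hq.integrable).div_const 2

theorem IsProbDensity.integrable_sqrt_mul (hp : IsProbDensity μ p) (hq : IsProbDensity μ q) :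
    Integrable (fun z => √(p z * q z)) μ := by
  refine (hp.integrable_add_div_two hq).mono'
    (hp.measurable.mul hq.measurable).sqrt.aestronglyMeasurable (.of_forall fun z => ?_)
  rw [Real.norm_of_nonneg (Real.sqrt_nonneg _)]
  exact sqrt_mul_le_add_div_two (hp.nonneg z) (hq.nonneg z)

theorem IsProbDensity.affinity_le_one (hp : IsProbDensity μ p) (hq : IsProbDensity μ q) :
    affinity μ p q ≤ 1 :=
  (integral_mono (hp.integrable_sqrt_mul hq) (hp.integrable_add_div_two hq) fun z =>
    sqrt_mul_le_add_div_two (hp.nonneg z) (hq.nonneg z)).trans_eq (hp.integral_add_div_two hq)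

theorem IsProbDensity.one_sub_le_affinity [IsProbabilityMeasure μ] (hp : IsProbDensity μ p)
    (hq : IsProbDensity μ q) {c : ℝ} (hc : 0 ≤ c)
    (hpq : ∀ᵐ z ∂μ, (p z - q z) ^ 2 ≤ 2 * c * (p z + q z)) : 1 - c ≤ affinity μ p q := by
  calc 1 - c = ∫ z, ((p z + q z) / 2 - c) ∂μ := by
        rw [integral_sub (hp.integrable_add_div_two hq) (integrable_const c),
          hp.integral_add_div_two hq, integral_const, probReal_univ, one_smul]
    _ ≤ affinity μ p q := by
        refine integral_mono_ae ((hp.integrable_add_div_two hq).sub (integrable_const c))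
          (hp.integrable_sqrt_mul hq) ?_
        filter_upwards [hpq] with z hz using add_div_two_sub_le_sqrt_mul hc hz

theorem IsProbDensity.affinity_sub_half_le_integral_min (hp : IsProbDensity μ p)
    (hq : IsProbDensity μ q) : affinity μ p q - 1 / 2 ≤ ∫ z, min (p z) (q z) ∂μ := by
  have half_mean : Integrable (fun z => (p z + q z) / 4) μ :=
    (hp.integrable.add hq.integrable).div_const 4
  calc affinity μ p q - 1 / 2
      = ∫ z, (√(p z * q z) - (p z + q z) / 4) ∂μ := by
        rw [integral_sub (hp.integrable_sqrt_mul hq) half_mean, integral_div,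
          integral_add hp.integrable hq.integrable, hp.integral_eq_one, hq.integral_eq_one,
          affinity]
        norm_num
    _ ≤ ∫ z, min (p z) (q z) ∂μ :=
        integral_mono ((hp.integrable_sqrt_mul hq).sub half_mean)
          (hp.integrable.inf hq.integrable) fun z => sqrt_mul_sub_le_min (hp.nonneg z) (hq.nonneg z)

theorem IsProbDensity.ofReal_integral_min_le_inf_withDensity (hp : IsProbDensity μ p)
    (hq : IsProbDensity μ q) : ENNReal.ofReal (∫ z, min (p z) (q z) ∂μ) ≤
      (μ.withDensity (fun z => .ofReal (p z)) ⊓ μ.withDensity fun z => .ofReal (q z)) .univ := by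
  have min_le : μ.withDensity (fun z => .ofReal (min (p z) (q z))) ≤
      μ.withDensity (fun z => .ofReal (p z)) ⊓ μ.withDensity fun z => .ofReal (q z) :=
    le_inf (withDensity_mono (.of_forall fun z => ENNReal.ofReal_le_ofReal (min_le_left _ _)))
      (withDensity_mono (.of_forall fun z => ENNReal.ofReal_le_ofReal (min_le_right _ _)))
  have integrable_min : Integrable (fun z => min (p z) (q z)) μ :=
    hp.integrable.inf hq.integrable
  rw [ofReal_integral_eq_lintegral_ofReal integrable_min
    (.of_forall fun z => le_min (hp.nonneg z) (hq.nonneg z)), ← setLIntegral_univ,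
    ← withDensity_apply _ .univ]
  exact min_le _

end Affinity

section Product

variable {ι : Type*} [Fintype ι] {Z : ι → Type*} [∀ i, MeasurableSpace (Z i)]
  {μ : ∀ i, Measure (Z i)} {p q : ∀ i, Z i → ℝ}

theorem IsProbDensity.pi [∀ i, SigmaFinite (μ i)] (hp : ∀ i, IsProbDensity (μ i) (p i)) :
    IsProbDensity (Measure.pi μ) fun z => ∏ i, p i (z i) where
  measurable := Finset.measurable_fun_prod _ fun i _ =>
    (hp i).measurable.comp (measurable_pi_apply i)
  nonneg z := Finset.prod_nonneg fun i _ => (hp i).nonneg (z i)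
  integral_eq_one := by
    rw [integral_fintype_prod_eq_prod]
    exact Finset.prod_eq_one fun i _ => (hp i).integral_eq_one

theorem affinity_pi [∀ i, SigmaFinite (μ i)] (hp : ∀ i z, 0 ≤ p i z) (hq : ∀ i z, 0 ≤ q i z) :
    affinity (Measure.pi μ) (fun z => ∏ i, p i (z i)) (fun z => ∏ i, q i (z i)) =
      ∏ i, affinity (μ i) (p i) (q i) := by
  simp only [affinity, ← Finset.prod_mul_distrib,
    Real.sqrt_prod _ fun i _ => mul_nonneg (hp i _) (hq i _)]
  exact integral_fintype_prod_eq_prod (fun i z => √(p i z * q i z))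

theorem pi_withDensity_ofReal [∀ i, SigmaFinite (μ i)] (hp : ∀ i, IsProbDensity (μ i) (p i)) :
    Measure.pi (fun i => (μ i).withDensity fun z => .ofReal (p i z)) =
      (Measure.pi μ).withDensity fun z => .ofReal (∏ i, p i (z i)) := by
  have _ i : IsFiniteMeasure ((μ i).withDensity fun z => .ofReal (p i z)) :=
    isFiniteMeasure_withDensity_ofReal (hp i).integrable.2
  refine Measure.pi_eq fun s hs => ?_
  rw [withDensity_apply _ (.univ_pi hs), Measure.restrict_pi_pi,
    ← ofReal_integral_eq_lintegral_ofReal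
      (.fintype_prod_dep fun i => (hp i).integrable.restrict)
      (.of_forall fun z => Finset.prod_nonneg fun i _ => (hp i).nonneg _),
    integral_fintype_prod_eq_prod,
    ENNReal.ofReal_prod_of_nonneg fun i _ => integral_nonneg (hp i).nonneg]
  refine Finset.prod_congr rfl fun i _ => ?_
  rw [withDensity_apply _ (hs i), ofReal_integral_eq_lintegral_ofReal (hp i).integrable.restrict
    (.of_forall (hp i).nonneg)]

theorem half_sub_sum_le_inf_pi_withDensity [∀ i, SigmaFinite (μ i)]
    (hp : ∀ i, IsProbDensity (μ i) (p i)) (hq : ∀ i, IsProbDensity (μ i) (q i)) {h : ι → ℝ}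
    (hpq : ∀ i, 1 - h i ≤ affinity (μ i) (p i) (q i)) :
    ENNReal.ofReal (1 / 2 - ∑ i, h i) ≤
      (Measure.pi (fun i => (μ i).withDensity fun z => .ofReal (p i z)) ⊓
        Measure.pi fun i => (μ i).withDensity fun z => .ofReal (q i z)) .univ := by
  rw [pi_withDensity_ofReal hp, pi_withDensity_ofReal hq]
  refine le_trans (ENNReal.ofReal_le_ofReal ?_)
    ((IsProbDensity.pi hp).ofReal_integral_min_le_inf_withDensity (.pi hq))
  have one_sub_sum_le : 1 - ∑ i, h i ≤ ∏ i, affinity (μ i) (p i) (q i) :=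
    one_sub_sum_le_prod (fun i _ => affinity_nonneg _ _ _)
      (fun i _ => (hp i).affinity_le_one (hq i)) fun i _ => hpq i
  have sub_half_le := (IsProbDensity.pi hp).affinity_sub_half_le_integral_min (.pi hq)
  rw [affinity_pi (fun i => (hp i).nonneg) fun i => (hq i).nonneg] at sub_half_le
  linarith

end Product

section Cube

theorem intUnit_cast_sq (s : ℤˣ) : ((s : ℤ) : ℝ) ^ 2 = 1 := by
  rcases Int.units_eq_one_or s with rfl | rfl <;> norm_num

variable {ι : Type*} [Fintype ι]

section Module

variable {E : Type*} [AddCommGroup E] [Module ℝ E]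

/-- The vertex with signs `τ` of the cube centered at `0` with half edges `δ • u j`, whose vertices
are the hypotheses of Assouad's method. -/
def cubeVertex (δ : ℝ) (u : ι → E) (τ : ι → ℤˣ) : E :=
  ∑ j, (δ * (τ j : ℤ)) • u j

theorem cubeVertex_mem {W : Submodule ℝ E} (δ : ℝ) {u : ι → E} (hu : ∀ j, u j ∈ W) (τ : ι → ℤˣ) :
    cubeVertex δ u τ ∈ W :=
  W.sum_mem fun j _ => W.smul_mem _ (hu j)

theorem map_cubeVertex {F G : Type*} [AddCommGroup F] [Module ℝ F] [FunLike G E F]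
    [LinearMapClass G ℝ E F] (A : G) (δ : ℝ) (u : ι → E) (τ : ι → ℤˣ) :
    A (cubeVertex δ u τ) = cubeVertex δ (fun j => A (u j)) τ := by
  simp only [cubeVertex, map_sum, map_smul]

theorem cubeVertex_sub_cubeVertex_flip [DecidableEq ι] (δ : ℝ) (u : ι → E) (τ : ι → ℤˣ) (j : ι) :
    cubeVertex δ u τ - cubeVertex δ u (Pi.mulSingle j (-1) * τ) = (2 * δ * (τ j : ℤ)) • u j := by
  rw [cubeVertex, cubeVertex, ← Finset.sum_sub_distrib,
    Finset.sum_eq_single_of_mem j (Finset.mem_univ j)]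
  · simp only [Pi.mul_apply, Pi.mulSingle_eq_same, ← sub_smul]
    push_cast
    ring_nf
  · intro k _ hk
    rw [Pi.mul_apply, Pi.mulSingle_eq_of_ne hk, one_mul, sub_self]

end Module

section InnerProduct

variable {F : Type*} [NormedAddCommGroup F] [InnerProductSpace ℝ F] {e : ι → F}

theorem norm_cubeVertex_sq (he : Orthonormal ℝ e) (δ : ℝ) (τ : ι → ℤˣ) :
    ‖cubeVertex δ e τ‖ ^ 2 = Fintype.card ι * δ ^ 2 := by
  rw [← real_inner_self_eq_norm_sq, cubeVertex, he.inner_sum]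
  simp [← sq, mul_pow, intUnit_cast_sq]

theorem sum_sq_inner_sub_le_norm_sub_cubeVertex_sq (he : Orthonormal ℝ e) (δ : ℝ) (τ : ι → ℤˣ)
    (v : F) :
    ∑ j, (inner ℝ (e j) v - δ * (τ j : ℤ)) ^ 2 ≤ ‖v - cubeVertex δ e τ‖ ^ 2 := by
  have coord j : inner ℝ (e j) (v - cubeVertex δ e τ) = inner ℝ (e j) v - δ * (τ j : ℤ) := by
    rw [inner_sub_right, cubeVertex, he.inner_right_fintype]
  simpa only [coord, Real.norm_eq_abs, sq_abs] using
    he.sum_inner_products_le (v - cubeVertex δ e τ) (s := .univ)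

end InnerProduct

end Cube

section Assouad

variable {ι Ω E : Type*} [MeasurableSpace Ω] [MeasurableSpace E]

theorem mul_inf_univ_le_lintegral_add_lintegral (P Q : Measure Ω)
    {L L' : Ω → ℝ≥0∞} (hL : Measurable L) {c : ℝ≥0∞} (hc : ∀ z, c ≤ L z + L' z) :
    c * (P ⊓ Q) .univ ≤ ∫⁻ z, L z ∂P + ∫⁻ z, L' z ∂Q :=
  calc c * (P ⊓ Q) .univ = ∫⁻ _, c ∂(P ⊓ Q) := (lintegral_const c).symm
    _ ≤ ∫⁻ z, (L z + L' z) ∂(P ⊓ Q) := lintegral_mono hc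
    _ = ∫⁻ z, L z ∂(P ⊓ Q) + ∫⁻ z, L' z ∂(P ⊓ Q) := lintegral_add_left hL L'
    _ ≤ ∫⁻ z, L z ∂P + ∫⁻ z, L' z ∂Q :=
      add_le_add (lintegral_mono' inf_le_left le_rfl) (lintegral_mono' inf_le_right le_rfl)

theorem two_mul_ofReal_sq_le_lintegral_add (P : Measure E)
    [IsProbabilityMeasure P] {g : E → ℝ} (hg : Measurable g) (δ : ℝ) :
    2 * ENNReal.ofReal (δ ^ 2) ≤
      ∫⁻ t, .ofReal ((g t - δ) ^ 2) ∂P + ∫⁻ t, .ofReal ((g t + δ) ^ 2) ∂P :=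
  calc 2 * ENNReal.ofReal (δ ^ 2) = ∫⁻ _, .ofReal (2 * δ ^ 2) ∂P := by
        rw [lintegral_const, measure_univ, mul_one, ENNReal.ofReal_mul zero_le_two,
          ENNReal.ofReal_ofNat]
    _ ≤ ∫⁻ t, (.ofReal ((g t - δ) ^ 2) + .ofReal ((g t + δ) ^ 2)) ∂P := by
        refine lintegral_mono fun t => ?_
        rw [← ENNReal.ofReal_add (sq_nonneg _) (sq_nonneg _)]
        exact ENNReal.ofReal_le_ofReal (by linarith [sq_nonneg (g t)])
    _ = ∫⁻ t, .ofReal ((g t - δ) ^ 2) ∂P + ∫⁻ t, .ofReal ((g t + δ) ^ 2) ∂P :=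
        lintegral_add_left (by fun_prop) _

variable [Fintype ι] [DecidableEq ι]

theorem exists_card_mul_le_sum_of_le_add_flip {r : ι → (ι → ℤˣ) → ℝ≥0∞} {c : ℝ≥0∞}
    (hr : ∀ j τ, 2 * c ≤ r j τ + r j (Pi.mulSingle j (-1) * τ)) :
    ∃ τ, Fintype.card ι * c ≤ ∑ j, r j τ := by
  have sum_ge j : ∑ _τ : ι → ℤˣ, c ≤ ∑ τ, r j τ := by
    have flip_sum : ∑ τ, r j (Pi.mulSingle j (-1) * τ) = ∑ τ, r j τ :=
      (Group.mulLeft_bijective (Pi.mulSingle j (-1) : ι → ℤˣ)).sum_comp (r j)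
    have pair_sum : ∑ _τ : ι → ℤˣ, 2 * c ≤ 2 * ∑ τ, r j τ := by
      rw [two_mul (∑ τ, r j τ)]
      nth_rw 2 [← flip_sum]
      rw [← Finset.sum_add_distrib]
      exact Finset.sum_le_sum fun τ _ => hr j τ
    rwa [← Finset.mul_sum, ENNReal.mul_le_mul_iff_right two_ne_zero ENNReal.ofNat_ne_top]
      at pair_sum
  by_contra! all_lt
  refine (ENNReal.sum_lt_sum_of_nonempty Finset.univ_nonempty fun τ _ => all_lt τ).not_ge ?_
  calc ∑ _τ : ι → ℤˣ, Fintype.card ι * c = ∑ _j : ι, ∑ _τ : ι → ℤˣ, c := by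
        simp only [Finset.sum_const, Finset.card_univ, nsmul_eq_mul]
        ring
    _ ≤ ∑ j, ∑ τ, r j τ := Finset.sum_le_sum fun j _ => sum_ge j
    _ = ∑ τ, ∑ j, r j τ := Finset.sum_comm

theorem exists_le_lintegral_sum_sq_sub {P : (ι → ℤˣ) → Measure Ω} (est : Kernel Ω E)
    [IsMarkovKernel est] {g : ι → E → ℝ} (hg : ∀ j, Measurable (g j)) {δ : ℝ} {c : ℝ≥0∞}
    (hP : ∀ τ j, c ≤ (P τ ⊓ P (Pi.mulSingle j (-1) * τ)) .univ) :
    ∃ τ, Fintype.card ι * (.ofReal (δ ^ 2) * c) ≤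
      ∫⁻ z, ∫⁻ t, .ofReal (∑ j, (g j t - δ * (τ j : ℤ)) ^ 2) ∂est z ∂P τ := by
  let loss (j : ι) (τ : ι → ℤˣ) (z : Ω) : ℝ≥0∞ :=
    ∫⁻ t, .ofReal ((g j t - δ * (τ j : ℤ)) ^ 2) ∂est z
  have measurable_loss j τ : Measurable (loss j τ) := Measurable.lintegral_kernel (by fun_prop)
  have loss_add_flip j τ z : 2 * .ofReal (δ ^ 2) ≤
      loss j τ z + loss j (Pi.mulSingle j (-1) * τ) z := by
    have two_point := two_mul_ofReal_sq_le_lintegral_add (est z) (hg j) (δ * (τ j : ℤ))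
    rw [mul_pow, intUnit_cast_sq, mul_one] at two_point
    simpa [loss] using two_point
  have risk_add_flip j τ : 2 * (.ofReal (δ ^ 2) * c) ≤ ∫⁻ z, loss j τ z ∂P τ +
      ∫⁻ z, loss j (Pi.mulSingle j (-1) * τ) z ∂P (Pi.mulSingle j (-1) * τ) := by
    rw [← mul_assoc]
    exact (mul_le_mul_right (hP τ j) _).trans
      (mul_inf_univ_le_lintegral_add_lintegral _ _ (measurable_loss j τ) (loss_add_flip j τ))
  obtain ⟨τ, hτ⟩ := exists_card_mul_le_sum_of_le_add_flip risk_add_flip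
  refine ⟨τ, hτ.trans_eq ?_⟩
  rw [← lintegral_finsetSum _ fun j _ => measurable_loss j τ]
  refine lintegral_congr fun z => ?_
  rw [← lintegral_finsetSum _ fun j _ => by fun_prop]
  exact lintegral_congr fun t => (ENNReal.ofReal_sum_of_nonneg fun j _ => sq_nonneg _).symm

variable {F : Type*} [NormedAddCommGroup E] [NormedSpace ℝ E] [OpensMeasurableSpace E]
  [NormedAddCommGroup F] [InnerProductSpace ℝ F]

theorem exists_le_lintegral_norm_map_sub_cubeVertex_sq (A : E →L[ℝ] F) {u : ι → E}
    (hu : Orthonormal ℝ fun j => A (u j)) {P : (ι → ℤˣ) → Measure Ω} (est : Kernel Ω E)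
    [IsMarkovKernel est] {δ : ℝ} {c : ℝ≥0∞}
    (hP : ∀ τ j, c ≤ (P τ ⊓ P (Pi.mulSingle j (-1) * τ)) .univ) :
    ∃ τ, Fintype.card ι * (.ofReal (δ ^ 2) * c) ≤
      ∫⁻ z, ∫⁻ t, .ofReal (‖A (t - cubeVertex δ u τ)‖ ^ 2) ∂est z ∂P τ := by
  have measurable_coord j : Measurable fun t => inner ℝ (A (u j)) (A t) := by
    refine Continuous.measurable ?_
    fun_prop
  obtain ⟨τ, hτ⟩ := exists_le_lintegral_sum_sq_sub est measurable_coord (δ := δ) hP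
  refine ⟨τ, hτ.trans (lintegral_mono fun z => lintegral_mono fun t =>
    ENNReal.ofReal_le_ofReal ?_)⟩
  rw [map_sub, map_cubeVertex]
  exact sum_sq_inner_sub_le_norm_sub_cubeVertex_sq hu δ τ (A t)

end Assouad

section BoundedDensityRatio

variable {Z : Type*} [MeasurableSpace Z] {μ ν : Measure Z}

theorem exists_isProbDensity_of_le_smul [SigmaFinite μ] [IsProbabilityMeasure ν] {C : ℝ}
    (hC : 0 ≤ C) (hνμ : ν ≤ ENNReal.ofReal C • μ) (hμν : μ ≤ ENNReal.ofReal C • ν) :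
    ∃ r : Z → ℝ, IsProbDensity μ r ∧ ν = μ.withDensity (fun z => .ofReal (r z)) ∧
      ∀ᵐ z ∂μ, r z ≤ C ∧ 1 ≤ C * r z := by
  have hac : ν ≪ μ :=
    (Measure.absolutelyContinuous_of_le hνμ).trans Measure.smul_absolutelyContinuous
  set ρ := ν.rnDeriv μ
  have measurable_ρ : Measurable ρ := Measure.measurable_rnDeriv ν μ
  have withDensity_ρ : μ.withDensity ρ = ν := Measure.withDensity_rnDeriv_eq ν μ hac
  have ρ_le : ρ ≤ᵐ[μ] fun _ => ENNReal.ofReal C := by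
    refine ae_le_of_forall_setLIntegral_le_of_sigmaFinite measurable_ρ fun S hS _ => ?_
    rw [← withDensity_apply ρ hS, withDensity_ρ, setLIntegral_const]
    exact hνμ S
  have one_le : (fun _ => 1) ≤ᵐ[μ] fun z => ENNReal.ofReal C * ρ z := by
    refine ae_le_of_forall_setLIntegral_le_of_sigmaFinite measurable_const fun S hS _ => ?_
    rw [lintegral_const_mul _ measurable_ρ, ← withDensity_apply ρ hS, withDensity_ρ,
      setLIntegral_one]
    exact hμν S
  refine ⟨fun z => (ρ z).toReal, ⟨measurable_ρ.ennreal_toReal, fun _ => ENNReal.toReal_nonneg, ?_⟩,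
    ?_, ?_⟩
  · rw [Measure.integral_toReal_rnDeriv hac, probReal_univ]
  · nth_rw 1 [← withDensity_ρ]
    refine withDensity_congr_ae ?_
    filter_upwards [Measure.rnDeriv_lt_top ν μ] with z hz using (ENNReal.ofReal_toReal hz.ne).symm
  · filter_upwards [ρ_le, one_le] with z hle hge
    have hge' := ENNReal.toReal_mono (ENNReal.mul_ne_top ENNReal.ofReal_ne_top
      (ne_top_of_le_ne_top ENNReal.ofReal_ne_top hle)) hge
    rw [ENNReal.toReal_one, ENNReal.toReal_mul, ENNReal.toReal_ofReal hC] at hge'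
    exact ⟨ENNReal.toReal_le_of_le_ofReal hC hle, hge'⟩

theorem IsLabelDP.exists_isProbDensity {ε : ℝ} {R : Kernel Bool Z} [IsMarkovKernel R]
    (hR : IsLabelDP ε R) : ∃ r : Z → ℝ, IsProbDensity (R false) r ∧
      R true = (R false).withDensity (fun z => .ofReal (r z)) ∧
      ∀ᵐ z ∂(R false), r z ≤ Real.exp ε ∧ 1 ≤ Real.exp ε * r z :=
  exists_isProbDensity_of_le_smul (Real.exp_nonneg ε)
    (Measure.le_iff.2 (hR true false)) (Measure.le_iff.2 (hR false true))

end BoundedDensityRatio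

section LabelMixture

/-- The density of a private view whose label is `true` with probability `s`, when the views of the
labels `false` and `true` have densities `1` and `r`. -/
def labelMixture {Z : Type*} (r : Z → ℝ) (s : ℝ) (z : Z) : ℝ :=
  s * r z + (1 - s)

theorem min_one_le_labelMixture {Z : Type*} (r : Z → ℝ) {s : ℝ} (hs : s ∈ Set.Icc 0 1) (z : Z) :
    min 1 (r z) ≤ labelMixture r s z := by
  rw [labelMixture]
  nlinarith [hs.1, hs.2, min_le_left 1 (r z), min_le_right 1 (r z)]

variable {Z : Type*} [MeasurableSpace Z] {μ : Measure Z} {r : Z → ℝ} {s t : ℝ}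

theorem btlLabelLaw_bind_eq_withDensity {d : ℕ} (x θ : EuclideanSpace ℝ (Fin d))
    {R : Kernel Bool Z} (hr : IsProbDensity (R false) r)
    (hR : R true = (R false).withDensity fun z => .ofReal (r z)) :
    (btlLabelLaw x θ).bind R =
      (R false).withDensity fun z => .ofReal (labelMixture r (Real.sigmoid (inner ℝ x θ)) z) := by
  set s := Real.sigmoid (inner ℝ x θ)
  have s_nonneg : 0 ≤ s := Real.sigmoid_nonneg _
  have s_le_one : s ≤ 1 := Real.sigmoid_le_one _
  have ofReal_mixture : (fun z => ENNReal.ofReal (labelMixture r s z)) =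
      ENNReal.ofReal s • (fun z => .ofReal (r z)) + fun _ => .ofReal (1 - s) := by
    ext z
    rw [labelMixture, ENNReal.ofReal_add (mul_nonneg s_nonneg (hr.nonneg z))
      (sub_nonneg.2 s_le_one), ENNReal.ofReal_mul s_nonneg]
    rfl
  rw [ofReal_mixture, withDensity_add_right _ measurable_const,
    withDensity_smul _ hr.measurable.ennreal_ofReal, withDensity_const, ← hR, btlLabelLaw,
    Measure.comp_add, Measure.comp_smul, Measure.comp_smul, Measure.dirac_bind R.measurable,
    Measure.dirac_bind R.measurable]

variable [IsProbabilityMeasure μ]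

theorem IsProbDensity.isProbDensity_labelMixture (hr : IsProbDensity μ r) (hs : s ∈ Set.Icc 0 1) :
    IsProbDensity μ (labelMixture r s) where
  measurable := (hr.measurable.const_mul s).add_const (1 - s)
  nonneg z := add_nonneg (mul_nonneg hs.1 (hr.nonneg z)) (sub_nonneg.2 hs.2)
  integral_eq_one := by
    simp only [labelMixture]
    rw [integral_add (hr.integrable.const_mul s) (integrable_const _), integral_const_mul,
      hr.integral_eq_one, integral_const, probReal_univ, one_smul, mul_one, add_sub_cancel]

theorem IsProbDensity.sqrt_add_sqrt_le_affinity_labelMixture (hr : IsProbDensity μ r)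
    (hs : s ∈ Set.Icc 0 1) (ht : t ∈ Set.Icc 0 1) :
    √(s * t) + √((1 - s) * (1 - t)) ≤ affinity μ (labelMixture r s) (labelMixture r t) := by
  have one_sub_s := sub_nonneg.2 hs.2
  have one_sub_t := sub_nonneg.2 ht.2
  have integrable_scaled : Integrable (fun z => √(s * t) * r z) μ := hr.integrable.const_mul _
  calc √(s * t) + √((1 - s) * (1 - t))
      = ∫ z, (√(s * t) * r z + √((1 - s) * (1 - t))) ∂μ := by
        rw [integral_add integrable_scaled (integrable_const _), integral_const_mul,
          hr.integral_eq_one, integral_const, probReal_univ, one_smul, mul_one]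
    _ ≤ affinity μ (labelMixture r s) (labelMixture r t) := by
        refine integral_mono (integrable_scaled.add (integrable_const _))
          ((hr.isProbDensity_labelMixture hs).integrable_sqrt_mul
            (hr.isProbDensity_labelMixture ht)) fun z => ?_
        have r_nonneg := hr.nonneg z
        have sqrt_scaled : √(s * r z * (t * r z)) = √(s * t) * r z := by
          rw [mul_mul_mul_comm, Real.sqrt_mul (mul_nonneg hs.1 ht.1), Real.sqrt_mul_self r_nonneg]
        exact sqrt_scaled ▸ sqrt_mul_add_sqrt_mul_le (mul_nonneg hs.1 r_nonneg) one_sub_s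
          (mul_nonneg ht.1 r_nonneg) one_sub_t

theorem IsProbDensity.one_sub_le_affinity_labelMixture (hr : IsProbDensity μ r)
    {C : ℝ} (hrC : ∀ᵐ z ∂μ, r z ≤ C ∧ 1 ≤ C * r z) (hs : s ∈ Set.Icc 0 1) (ht : t ∈ Set.Icc 0 1) :
    1 - (C - 1) ^ 2 * (s - t) ^ 2 / 4 ≤ affinity μ (labelMixture r s) (labelMixture r t) := by
  refine (hr.isProbDensity_labelMixture hs).one_sub_le_affinity
    (hr.isProbDensity_labelMixture ht) (by positivity) ?_
  filter_upwards [hrC] with z ⟨hle, hge⟩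
  have mixture_ge := add_le_add (min_one_le_labelMixture r hs z) (min_one_le_labelMixture r ht z)
  calc (labelMixture r s z - labelMixture r t z) ^ 2 = (s - t) ^ 2 * (r z - 1) ^ 2 := by
        rw [labelMixture, labelMixture]
        ring
    _ ≤ (s - t) ^ 2 * ((C - 1) ^ 2 * min 1 (r z)) := by
        gcongr
        exact sq_sub_one_le_mul_min (hr.nonneg z) hle hge
    _ = 2 * ((C - 1) ^ 2 * (s - t) ^ 2 / 4) * (min 1 (r z) + min 1 (r z)) := by ring
    _ ≤ 2 * ((C - 1) ^ 2 * (s - t) ^ 2 / 4) * (labelMixture r s z + labelMixture r t z) := by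
        gcongr

end LabelMixture

section PrivateView

/-- The factor by which local `ε`-label differential privacy shrinks the information about `θ`
carried by one label. The cap `1` is data processing: a private view is never more informative than
the label itself. -/
noncomputable def privacyFactor (ε : ℝ) : ℝ :=
  min 1 ((Real.exp ε - 1) ^ 2)

theorem privacyFactor_pos {ε : ℝ} (hε : ε ≠ 0) : 0 < privacyFactor ε :=
  lt_min one_pos (sq_pos_of_ne_zero (sub_ne_zero.2 (by simpa using hε)))

theorem div_add_div_le_two_mul_div_privacyFactor {ε : ℝ} (hε : ε ≠ 0) (d n : ℕ) :
    (d : ℝ) / n + d / ((Real.exp ε - 1) ^ 2 * n) ≤ 2 * d / (privacyFactor ε * n) := by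
  have κ_pos := privacyFactor_pos hε
  have one_le : 1 ≤ (privacyFactor ε)⁻¹ := (one_le_inv₀ κ_pos).2 (min_le_left _ _)
  have inv_le : ((Real.exp ε - 1) ^ 2)⁻¹ ≤ (privacyFactor ε)⁻¹ :=
    inv_anti₀ κ_pos (min_le_right _ _)
  calc (d : ℝ) / n + d / ((Real.exp ε - 1) ^ 2 * n)
      = d / n * (1 + ((Real.exp ε - 1) ^ 2)⁻¹) := by
        rw [mul_comm (_ ^ 2), ← div_div]
        ring
    _ ≤ d / n * ((privacyFactor ε)⁻¹ + (privacyFactor ε)⁻¹) := by gcongr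
    _ = 2 * d / (privacyFactor ε * n) := by ring

theorem IsProbDensity.one_sub_privacyFactor_le_affinity {Z : Type*} [MeasurableSpace Z]
    {μ : Measure Z} [IsProbabilityMeasure μ] {r : Z → ℝ} (hr : IsProbDensity μ r) {ε : ℝ}
    (hrε : ∀ᵐ z ∂μ, r z ≤ Real.exp ε ∧ 1 ≤ Real.exp ε * r z) (a b : ℝ) :
    1 - privacyFactor ε * (a - b) ^ 2 ≤
      affinity μ (labelMixture r (Real.sigmoid a)) (labelMixture r (Real.sigmoid b)) := by
  rcases min_choice 1 ((Real.exp ε - 1) ^ 2) with factor_eq | factor_eq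
  · rw [privacyFactor, factor_eq, one_mul]
    exact (one_sub_sq_le_sqrt_sigmoid a b).trans
      (hr.sqrt_add_sqrt_le_affinity_labelMixture (sigmoid_mem_Icc a) (sigmoid_mem_Icc b))
  · rw [privacyFactor, factor_eq]
    refine le_trans ?_
      (hr.one_sub_le_affinity_labelMixture hrε (sigmoid_mem_Icc a) (sigmoid_mem_Icc b))
    have mul_le := mul_le_mul_of_nonneg_left (sq_sigmoid_sub_le a b)
      (sq_nonneg (Real.exp ε - 1))
    have mul_nonneg : 0 ≤ (Real.exp ε - 1) ^ 2 * (a - b) ^ 2 := by positivity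
    linarith

theorem half_sub_le_inf_privateViewLaw {d n : ℕ} {Z : Type*} [MeasurableSpace Z]
    (x : Fin n → EuclideanSpace ℝ (Fin d)) {R : Fin n → Kernel Bool Z} [∀ i, IsMarkovKernel (R i)]
    {ε : ℝ} (hR : ∀ i, IsLabelDP ε (R i)) (θ θ' : EuclideanSpace ℝ (Fin d)) :
    ENNReal.ofReal (1 / 2 - privacyFactor ε * ∑ i, inner ℝ (x i) (θ - θ') ^ 2) ≤
      (privateViewLaw x R θ ⊓ privateViewLaw x R θ') .univ := by
  choose r hr hrR hrε using fun i => (hR i).exists_isProbDensity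
  simp only [privateViewLaw, btlLabelLaw_bind_eq_withDensity _ _ (hr _) (hrR _), Finset.mul_sum,
    inner_sub_right]
  exact half_sub_sum_le_inf_pi_withDensity
    (fun i => (hr i).isProbDensity_labelMixture (sigmoid_mem_Icc _))
    (fun i => (hr i).isProbDensity_labelMixture (sigmoid_mem_Icc _))
    fun i => (hr i).one_sub_privacyFactor_le_affinity (hrε i) _ _

end PrivateView

section Geometry

variable {d n : ℕ} {lam : ℝ}

/-- The linear map `v ↦ (⟨x i, v⟩ / √n, √λ v)`, which turns the semi-norm `‖·‖_{Σ_D + λ I}` into a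
Euclidean norm. -/
noncomputable def covEmbedding (lam : ℝ) (x : Fin n → EuclideanSpace ℝ (Fin d)) :
    EuclideanSpace ℝ (Fin d) →L[ℝ] EuclideanSpace ℝ (Fin n ⊕ Fin d) :=
  LinearMap.toContinuousLinearMap
    { toFun v := WithLp.toLp 2 (Sum.elim (fun i => (√n)⁻¹ * inner ℝ (x i) v) fun k => √lam * v k)
      map_add' u v := by
        ext (_ | _) <;> simp [inner_add_right, mul_add]
      map_smul' c v := by
        ext (_ | _) <;> simp [inner_smul_right, mul_left_comm] }

theorem norm_covEmbedding_sq (hlam : 0 ≤ lam) (x : Fin n → EuclideanSpace ℝ (Fin d))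
    (v : EuclideanSpace ℝ (Fin d)) :
    ‖covEmbedding lam x v‖ ^ 2 = (n : ℝ)⁻¹ * ∑ i, inner ℝ (x i) v ^ 2 + lam * ‖v‖ ^ 2 := by
  rw [EuclideanSpace.real_norm_sq_eq, EuclideanSpace.real_norm_sq_eq, Fintype.sum_sum_type]
  simp [covEmbedding, mul_pow, Finset.mul_sum, Real.sq_sqrt hlam]

theorem mul_norm_sq_le_norm_covEmbedding_sq (hlam : 0 ≤ lam)
    (x : Fin n → EuclideanSpace ℝ (Fin d)) (v : EuclideanSpace ℝ (Fin d)) :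
    lam * ‖v‖ ^ 2 ≤ ‖covEmbedding lam x v‖ ^ 2 := by
  rw [norm_covEmbedding_sq hlam]
  exact le_add_of_nonneg_left (by positivity)

theorem sum_sq_inner_le_mul_norm_covEmbedding_sq (hlam : 0 ≤ lam)
    (x : Fin n → EuclideanSpace ℝ (Fin d)) (v : EuclideanSpace ℝ (Fin d)) :
    ∑ i, inner ℝ (x i) v ^ 2 ≤ n * ‖covEmbedding lam x v‖ ^ 2 := by
  rcases n.eq_zero_or_pos with rfl | n_pos
  · simp
  · rw [norm_covEmbedding_sq hlam, mul_add, mul_inv_cancel_left₀ (by positivity)]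
    exact le_add_of_nonneg_right (by positivity)

theorem covEmbedding_injective (hlam : 0 < lam) (x : Fin n → EuclideanSpace ℝ (Fin d)) :
    Function.Injective (covEmbedding lam x) := by
  refine (injective_iff_map_eq_zero _).2 fun v hv => ?_
  have mul_norm_le := mul_norm_sq_le_norm_covEmbedding_sq hlam.le x v
  rw [hv, norm_zero, zero_pow two_ne_zero] at mul_norm_le
  simpa using nonpos_of_mul_nonpos_right mul_norm_le hlam

theorem dotProduct_sampleCov_mulVec (x : Fin n → EuclideanSpace ℝ (Fin d))
    (v : EuclideanSpace ℝ (Fin d)) :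
    v.ofLp ⬝ᵥ (sampleCov x).mulVec v.ofLp = (n : ℝ)⁻¹ * ∑ i, inner ℝ (x i) v ^ 2 := by
  rw [sampleCov, Matrix.smul_mulVec, dotProduct_smul, Matrix.sum_mulVec, dotProduct_sum,
    smul_eq_mul]
  congr 1
  refine Finset.sum_congr rfl fun i _ => ?_
  rw [Matrix.vecMulVec_mulVec, EuclideanSpace.inner_eq_star_dotProduct, star_trivial,
    op_smul_eq_smul, dotProduct_smul, smul_eq_mul, dotProduct_comm v.ofLp, sq, dotProduct_comm]

theorem matrixNorm_sq_eq_norm_covEmbedding_sq (hlam : 0 ≤ lam)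
    (x : Fin n → EuclideanSpace ℝ (Fin d)) (v : EuclideanSpace ℝ (Fin d)) :
    matrixNorm (sampleCov x + lam • 1) v ^ 2 = ‖covEmbedding lam x v‖ ^ 2 := by
  have quadratic_form :
      v.ofLp ⬝ᵥ (sampleCov x + lam • 1).mulVec v.ofLp = ‖covEmbedding lam x v‖ ^ 2 := by
    rw [norm_covEmbedding_sq hlam, Matrix.add_mulVec, dotProduct_add, dotProduct_sampleCov_mulVec,
      Matrix.smul_mulVec, Matrix.one_mulVec, dotProduct_smul, smul_eq_mul,
      EuclideanSpace.real_norm_sq_eq]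
    simp only [dotProduct, sq]
  rw [matrixNorm, quadratic_form, Real.sqrt_sq (norm_nonneg _)]

theorem exists_orthonormal_map {E F : Type*} [AddCommGroup E] [Module ℝ E]
    [NormedAddCommGroup F] [InnerProductSpace ℝ F] {A : E →ₗ[ℝ] F} (hA : Function.Injective A)
    {W : Submodule ℝ E} [FiniteDimensional ℝ W] {m : ℕ} (hW : Module.finrank ℝ W = m) :
    ∃ u : Fin m → E, (∀ j, u j ∈ W) ∧ Orthonormal ℝ fun j => A (u j) := by
  have finrank_map : Module.finrank ℝ (W.map A) = m :=
    (W.equivMapOfInjective A hA).finrank_eq.symm.trans hW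
  let e := (stdOrthonormalBasis ℝ (W.map A)).reindex (finCongr finrank_map)
  choose u u_mem map_u using fun j => Submodule.mem_map.1 (e j).2
  refine ⟨u, u_mem, ?_⟩
  simp only [map_u]
  exact e.orthonormal.comp_linearIsometry (W.map A).subtypeₗᵢ

/-- The hyperplane of vectors whose coordinates sum to zero, encoded as the orthogonal complement
of the all-ones vector. -/
noncomputable def sumZero (d : ℕ) : Submodule ℝ (EuclideanSpace ℝ (Fin d)) :=
  (ℝ ∙ WithLp.toLp 2 1)ᗮ

theorem mem_sumZero_iff {v : EuclideanSpace ℝ (Fin d)} : v ∈ sumZero d ↔ ∑ j, v j = 0 := by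
  simp [sumZero, Submodule.mem_orthogonal_singleton_iff_inner_right, PiLp.inner_apply]

theorem finrank_sumZero (m : ℕ) : Module.finrank ℝ (sumZero (m + 1)) = m := by
  have _ : Fact (Module.finrank ℝ (EuclideanSpace ℝ (Fin (m + 1))) = m + 1) :=
    ⟨finrank_euclideanSpace_fin⟩
  refine Submodule.finrank_orthogonal_span_singleton fun ones_eq_zero => ?_
  simpa using congrArg (fun v : EuclideanSpace ℝ (Fin (m + 1)) => v 0) ones_eq_zero

end Geometry

section LowerBound

variable {n : ℕ} {lam ε δ : ℝ} {Z : Type*} [MeasurableSpace Z] {R : Fin n → Kernel Bool Z}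
  [∀ i, IsMarkovKernel (R i)]

theorem quarter_le_inf_privateViewLaw_cubeVertex_flip {d : ℕ} {ι : Type*} [Fintype ι]
    [DecidableEq ι] (hlam : 0 ≤ lam) (x : Fin n → EuclideanSpace ℝ (Fin d))
    (hR : ∀ i, IsLabelDP ε (R i)) {u : ι → EuclideanSpace ℝ (Fin d)}
    (hu : ∀ j, ‖covEmbedding lam x (u j)‖ = 1) (hδ : 16 * privacyFactor ε * n * δ ^ 2 ≤ 1)
    (τ : ι → ℤˣ) (j : ι) :
    ENNReal.ofReal (1 / 4) ≤ (privateViewLaw x R (cubeVertex δ u τ) ⊓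
      privateViewLaw x R (cubeVertex δ u (Pi.mulSingle j (-1) * τ))) .univ := by
  refine le_trans (ENNReal.ofReal_le_ofReal ?_) (half_sub_le_inf_privateViewLaw x hR _ _)
  have sum_sq_inner_eq : ∑ i, inner ℝ (x i) (cubeVertex δ u τ -
      cubeVertex δ u (Pi.mulSingle j (-1) * τ)) ^ 2 = 4 * δ ^ 2 * ∑ i, inner ℝ (x i) (u j) ^ 2 := by
    simp only [cubeVertex_sub_cubeVertex_flip, inner_smul_right, mul_pow, intUnit_cast_sq,
      ← Finset.mul_sum]
    ring
  have sum_sq_inner_le := sum_sq_inner_le_mul_norm_covEmbedding_sq hlam x (u j)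
  rw [hu j, one_pow, mul_one] at sum_sq_inner_le
  have factor_nonneg : 0 ≤ privacyFactor ε * (4 * δ ^ 2) :=
    mul_nonneg (le_min zero_le_one (sq_nonneg _)) (by positivity)
  rw [sum_sq_inner_eq, ← mul_assoc]
  linarith [mul_le_mul_of_nonneg_left sum_sq_inner_le factor_nonneg]

theorem exists_mem_paramSet_le_semiNormRisk {m : ℕ} {B : ℝ} (hB : 0 ≤ B) (hlam : 0 < lam)
    (x : Fin n → EuclideanSpace ℝ (Fin (m + 1))) (hR : ∀ i, IsLabelDP ε (R i))
    (est : Kernel (Fin n → Z) (EuclideanSpace ℝ (Fin (m + 1)))) [IsMarkovKernel est]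
    (hδ : 16 * privacyFactor ε * n * δ ^ 2 ≤ 1) (hδB : m * δ ^ 2 ≤ lam * B ^ 2) :
    ∃ θ ∈ paramSet (m + 1) B, ENNReal.ofReal (m * δ ^ 2 / 4) ≤ semiNormRisk lam x R est θ := by
  obtain ⟨u, u_mem, (hu : Orthonormal ℝ fun j => covEmbedding lam x (u j))⟩ :=
    exists_orthonormal_map (A := (covEmbedding lam x).toLinearMap) (covEmbedding_injective hlam x)
      (finrank_sumZero m)
  obtain ⟨τ, hτ⟩ := exists_le_lintegral_norm_map_sub_cubeVertex_sq (covEmbedding lam x)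
    hu est (quarter_le_inf_privateViewLaw_cubeVertex_flip hlam.le x hR hu.norm_eq_one hδ)
  rw [Fintype.card_fin] at hτ
  refine ⟨cubeVertex δ u τ, ⟨mem_sumZero_iff.1 (cubeVertex_mem δ u_mem τ), ?_⟩, ?_⟩
  · have norm_map_sq : ‖covEmbedding lam x (cubeVertex δ u τ)‖ ^ 2 = m * δ ^ 2 := by
      rw [map_cubeVertex, norm_cubeVertex_sq hu, Fintype.card_fin]
    have mul_norm_sq_le := (mul_norm_sq_le_norm_covEmbedding_sq hlam.le x _).trans_eq norm_map_sq
    exact le_of_sq_le_sq (le_of_mul_le_mul_left (mul_norm_sq_le.trans hδB) hlam) hB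
  · simp only [semiNormRisk, matrixNorm_sq_eq_norm_covEmbedding_sq hlam.le]
    refine le_of_eq_of_le ?_ hτ
    rw [← ENNReal.ofReal_mul (sq_nonneg δ), ← ENNReal.ofReal_natCast,
      ← ENNReal.ofReal_mul m.cast_nonneg]
    ring_nf

end LowerBound

theorem mainTheorem2 :
    ∃ c : ℝ, 0 < c ∧
      ∀ (d : ℕ) (B lam ε : ℝ), 2 ≤ d → 0 < B → 0 < lam → 0 < ε →
        ∃ N : ℕ, ∀ n : ℕ, N ≤ n →
          ∀ (x : Fin n → EuclideanSpace ℝ (Fin d))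
            (Z : Type*) [MeasurableSpace Z]
            (R : Fin n → Kernel Bool Z) [∀ i, IsMarkovKernel (R i)]
            (est : Kernel (Fin n → Z) (EuclideanSpace ℝ (Fin d))) [IsMarkovKernel est],
            (∀ i, IsLabelDP ε (R i)) →
              ∃ θ ∈ paramSet d B,
                ENNReal.ofReal
                    (c * ((d : ℝ) / n + (d : ℝ) / ((Real.exp ε - 1) ^ 2 * n))) ≤
                  semiNormRisk lam x R est θ := by
  refine ⟨1 / 256, by norm_num, fun d B lam ε hd hB hlam hε => ?_⟩
  obtain ⟨m, rfl⟩ : ∃ m, d = m + 1 := ⟨d - 1, by omega⟩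
  have κ_pos := privacyFactor_pos hε.ne'
  set κ := privacyFactor ε
  refine ⟨⌈m / (16 * κ * lam * B ^ 2)⌉₊ + 1, fun n hn x Z _ R _ est _ hR => ?_⟩
  have n_pos : (0 : ℝ) < n := by exact_mod_cast (Nat.succ_pos _).trans_le hn
  have m_le : m ≤ n * (16 * κ * lam * B ^ 2) :=
    (div_le_iff₀ (by positivity)).1 (Nat.ceil_le.1 ((Nat.le_succ _).trans hn))
  have δ_sq : √(1 / (16 * κ * n)) ^ 2 = 1 / (16 * κ * n) := Real.sq_sqrt (by positivity)
  obtain ⟨θ, θ_mem, risk_ge⟩ := exists_mem_paramSet_le_semiNormRisk (m := m)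
    (δ := √(1 / (16 * κ * n))) hB.le hlam x hR est
    (by rw [δ_sq, mul_one_div_cancel (by positivity)])
    (by rw [δ_sq, mul_one_div, div_le_iff₀ (by positivity)]; linarith)
  refine ⟨θ, θ_mem, le_trans (ENNReal.ofReal_le_ofReal ?_) risk_ge⟩
  have d_le : ((m + 1 : ℕ) : ℝ) ≤ 2 * m := by exact_mod_cast (by omega : m + 1 ≤ 2 * m)
  calc 1 / 256 * (((m + 1 : ℕ) : ℝ) / n + (m + 1 : ℕ) / ((Real.exp ε - 1) ^ 2 * n))
      ≤ 1 / 256 * (2 * (m + 1 : ℕ) / (κ * n)) := by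
        gcongr
        exact div_add_div_le_two_mul_div_privacyFactor hε.ne' _ _
    _ ≤ 1 / 256 * (2 * (2 * m) / (κ * n)) := by gcongr
    _ = m * √(1 / (16 * κ * n)) ^ 2 / 4 := by rw [δ_sq]; ring
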